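/- Let $X$ be a complex Banach space, $L(X)$ the algebra of bounded linear operators on $X$, $K(X)$ the ideal of compact operators, $\mathcal C(X)=L(X)/K(X)$ the Calkin algebra and $\Pi:L(X)\to\mathcal C(X)$ the canonical projection. An element $a$ of a unital ring is *quasinilpotent* if $1-xa$ is invertible for every $x$ commuting with $a$. For an idempotent $p$ of a unital ring and an element $a$ with $ap=pa$, $a$ is *left* (resp. *right*) *$p$-invertible* if $a+p$ has a left (resp. right) inverse commuting with $p$, and *$p$-invertible* if $a+p$ is invertible. Let $T\in L(X)$. An idempotent $P\in L(X)$ is *associated to $T$ in the left* (resp. *right*, *two-sided*) *sense* if $\Pi(P)\Pi(T)=\Pi(T)\Pi(P)$, $\Pi(P)\Pi(T)$ is quasinilpotent in $\mathcal C(X)$, and $\Pi(T)$ is left $\Pi(P)$-invertible (resp. right $\Pi(P)$-invertible, $\Pi(P)$-invertible) in $\mathcal C(X)$. The operator $T$ is *left pseudo semi-B-Fredholm* (resp. *right pseudo semi-B-Fredholm*, *pseudo B-Fredholm*) if there is an idempotent associated to it in the left (resp. right, two-sided) sense. If $P$ is an idempotent associated to $T$ in any of these senses, the index of $T$ is $\mathbf{ind}(T)=\dim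 N(T+P)-\operatorname{codim}R(T+P)\in\mathbb Z\cup\{\pm\infty\}$. For an idempotent $P\in L(X)$ write $T_1=(PTP)|_{R(P)}\in L(R(P))$. **Theorem.** 0. The index is well defined: if $P$ is associated to $T$ in any of the three senses, then $\dim N(T+P)$ or $\operatorname{codim} R(T+P)$ is finite, and $\dim N(T+P)-\operatorname{codim}R(T+P)$ does not depend on the choice of $P$. 1. Let $S,T\in L(X)$ be left (resp. right) pseudo semi-B-Fredholm operators such that there is an idempotent $P\in L(X)$ associated to both $S$ and $T$ in the left (resp. right) sense, and suppose that the commutator $[S_1,T_1]=S_1T_1-T_1S_1$ is compact. Then $ST$ is a left (resp. right) pseudo semi-B-Fredholm operator and $\mathbf{ind}(ST)=\mathbf{ind}(S)+\mathbf{ind}(T)$. 2. Let $S,T\in L(X)$ be pseudo B-Fredholm operators such that there is an idempotent $P\in L(X)$ associated to both $S$ and $T$ in the two-sided sense, and suppose that $[S_1,T_1]$ is compact. Then $ST$ is a pseudo B-Fredholm operator and $\mathbf{ind}(ST)=\mathbf{ind}(S)+\mathbf{ind}(T)$. -/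

import Mathlib

open scoped ENNReal

noncomputable section

namespace FredholmType

section Ring

variable {A : Type*} [Ring A]

/-- `a` is quasinilpotent in the ring `A`: `1 - x a` is invertible for every `x` commuting
with `a`. -/
def IsQuasinilpotent (a : A) : Prop :=
  ∀ x : A, x * a = a * x → IsUnit (1 - x * a)

/-- `a` is left `p`-invertible: `a` commutes with `p`, and `a + p` has a left inverse in the
commutant of `p`. -/
def IsLeftPInvertible (p a : A) : Prop :=
  a * p = p * a ∧ ∃ b : A, b * p = p * b ∧ b * (a + p) = 1

/-- `a` is right `p`-invertible: `a` commutes with `p`, and `a + p` has a right inverse in the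
commutant of `p`. -/
def IsRightPInvertible (p a : A) : Prop :=
  a * p = p * a ∧ ∃ b : A, b * p = p * b ∧ (a + p) * b = 1

/-- `a` is `p`-invertible: `a` commutes with `p`, and `a + p` is invertible. -/
def IsPInvertible (p a : A) : Prop :=
  a * p = p * a ∧ IsUnit (a + p)

end Ring

section Operators

variable {X : Type*} [NormedAddCommGroup X] [NormedSpace ℂ X]

variable (X) in
/-- The ideal `K(X)` of compact operators in `L(X)`. -/
def compactIdeal : Ideal (X →L[ℂ] X) where
  carrier := {T | IsCompactOperator T}
  add_mem' hS hT := hS.add hT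
  zero_mem' := isCompactOperator_zero
  smul_mem' S _ hT := hT.clm_comp S

instance : (compactIdeal X).IsTwoSided where
  mul_mem_of_left S hT := IsCompactOperator.comp_clm hT S

variable (X) in
/-- The Calkin algebra `C(X) = L(X) / K(X)`. -/
abbrev Calkin : Type _ := (X →L[ℂ] X) ⧸ compactIdeal X

/-- The canonical projection `Π : L(X) → C(X)`. -/
abbrev calkinMap : (X →L[ℂ] X) →+* Calkin X := Ideal.Quotient.mk (compactIdeal X)

/-- `P` is an idempotent of `L(X)` associated to `T` in `C(X)`, in the left sense. -/
structure IsLeftAssociated (P T : X →L[ℂ] X) : Prop where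
  idem : P * P = P
  comm : calkinMap P * calkinMap T = calkinMap T * calkinMap P
  quasinilpotent : IsQuasinilpotent (calkinMap P * calkinMap T)
  leftInv : IsLeftPInvertible (calkinMap P) (calkinMap T)

/-- `P` is an idempotent of `L(X)` associated to `T` in `C(X)`, in the right sense. -/
structure IsRightAssociated (P T : X →L[ℂ] X) : Prop where
  idem : P * P = P
  comm : calkinMap P * calkinMap T = calkinMap T * calkinMap P
  quasinilpotent : IsQuasinilpotent (calkinMap P * calkinMap T)
  rightInv : IsRightPInvertible (calkinMap P) (calkinMap T)

/-- `P` is an idempotent of `L(X)` associated to `T` in `C(X)`, in the two-sided sense. -/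
structure IsTwoSidedAssociated (P T : X →L[ℂ] X) : Prop where
  idem : P * P = P
  comm : calkinMap P * calkinMap T = calkinMap T * calkinMap P
  quasinilpotent : IsQuasinilpotent (calkinMap P * calkinMap T)
  inv : IsPInvertible (calkinMap P) (calkinMap T)

/-- `P` is associated to `T` in `C(X)`, in one of the three senses. -/
def IsAssociated (P T : X →L[ℂ] X) : Prop :=
  IsLeftAssociated P T ∨ IsRightAssociated P T ∨ IsTwoSidedAssociated P T

/-- Left pseudo semi-B-Fredholm: `Π(T)` is left generalized Drazin invertible in `C(X)`. -/
def IsLeftPseudoSemiBFredholm (T : X →L[ℂ] X) : Prop :=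
  ∃ P : X →L[ℂ] X, IsLeftAssociated P T

/-- Right pseudo semi-B-Fredholm: `Π(T)` is right generalized Drazin invertible in `C(X)`. -/
def IsRightPseudoSemiBFredholm (T : X →L[ℂ] X) : Prop :=
  ∃ P : X →L[ℂ] X, IsRightAssociated P T

/-- Pseudo B-Fredholm: `Π(T)` is generalized Drazin invertible in `C(X)`. -/
def IsPseudoBFredholm (T : X →L[ℂ] X) : Prop :=
  ∃ P : X →L[ℂ] X, IsTwoSidedAssociated P T

/-- The nullity `α(T)`, the dimension of the kernel, as a natural number or `∞`. -/
def nullity (T : X →L[ℂ] X) : ℕ∞ :=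
  Cardinal.toENat (Module.rank ℂ (LinearMap.ker (T : X →ₗ[ℂ] X)))

/-- The defect `β(T)`, the codimension of the range, as a natural number or `∞`. -/
def defect (T : X →L[ℂ] X) : ℕ∞ :=
  Cardinal.toENat (Module.rank ℂ (X ⧸ LinearMap.range (T : X →ₗ[ℂ] X)))

/-- The usual index `α(T) - β(T)` of a semi-Fredholm operator, an integer or `±∞` (it is used only
where `α(T)` or `β(T)` is finite). -/
def semiFredholmIndex (T : X →L[ℂ] X) : EReal :=
  (((nullity T : ℕ∞) : ℝ≥0∞) : EReal) - (((defect T : ℕ∞) : ℝ≥0∞) : EReal)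

open Classical in
/-- The index of a pseudo semi-B-Fredholm operator `T`: the usual index of `T + P`, where `P` is an
idempotent associated to `T` in `C(X)` (and `0` if there is none). -/
def ind (T : X →L[ℂ] X) : EReal :=
  if h : ∃ P : X →L[ℂ] X, IsAssociated P T then semiFredholmIndex (T + h.choose) else 0

/-- The compression `T₁ = (P T P)|_{R(P)}`, an operator on the range `R(P)`. -/
def compression (P T : X →L[ℂ] X) :
    LinearMap.range (P : X →ₗ[ℂ] X) →L[ℂ] LinearMap.range (P : X →ₗ[ℂ] X) :=
  ((P * T * P) ∘L (LinearMap.range (P : X →ₗ[ℂ] X)).subtypeL).codRestrict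
    (LinearMap.range (P : X →ₗ[ℂ] X)) (fun x => ⟨T (P x), rfl⟩)

end Operators

end FredholmType

end

/-! The problem reduces to semi-Fredholm operators. If `P` is associated to `T`, then `T + P` is
left or right invertible in the Calkin algebra, so its kernel has finite dimension or its range has
finite codimension. The index is additive on products of operators invertible on the same side
(six-term exact sequence) and vanishes on compact perturbations of the identity (Riesz theory).
Together these facts show that it depends only on the class in the Calkin algebra:
`IsSemiInvertible.semiFredholmIndex_congr`.

Independence of the idempotent: let `p`, `q` be the classes of two idempotents associated to `T`,
and `t` that of `T`. If `a` is quasinilpotent, `y = b y a` or `y = a y b` forces `y = 0`. Applied to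
`(1 - p) q` or `q (1 - p)`, this gives `p q = q` or `q p = q`, and likewise with `p` and `q`
exchanged. Hence `t + p` and `t + q` are conjugate by a unit (`exists_isUnit_mul_add_eq`), and
conjugation preserves the index.

Products: the index of `S T` is that of `S T + P`, which is not `(S + P)(T + P)`. Since the
compressions commute modulo compacts, however, `(1 + PS)(1 + PT)(ST + P)` and `(1 + PST)(S + P)(T +
P)` have the same class (`one_add_mul_one_add_mul_eq`). The correction factors are `1` plus a
quasinilpotent class, so a segment of Fredholm operators joins them to `1` and their index is zero
(`semiFredholmIndex_one_add_eq_zero`). The same commutation makes the class of `PST` quasinilpotent,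
so `P` stays associated to `S T`. -/

noncomputable section

namespace FredholmType

/-! ### Algebra of the index: exact sequence, additivity, values in `EReal`. -/

section Index

/-- Kernels and cokernels of two linear maps and of their composition fit into a six term exact
sequence; the `rᵢ` are the ranks of its five maps. -/
theorem exists_rank_ker_rank_coker_comp {K : Type*} {V : Type*} [Field K] [AddCommGroup V]
    [Module K V] (S T : V →ₗ[K] V) :
    ∃ r₁ r₂ r₃ r₄ r₅ : Cardinal,
      Module.rank K (LinearMap.ker T) = r₁ ∧
      Module.rank K (LinearMap.ker (S ∘ₗ T)) = r₁ + r₂ ∧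
      Module.rank K (LinearMap.ker S) = r₂ + r₃ ∧
      Module.rank K (V ⧸ LinearMap.range T) = r₃ + r₄ ∧
      Module.rank K (V ⧸ LinearMap.range (S ∘ₗ T)) = r₄ + r₅ ∧
      Module.rank K (V ⧸ LinearMap.range S) = r₅ := by
  set f₁ : LinearMap.ker T →ₗ[K] LinearMap.ker (S ∘ₗ T) :=
    Submodule.inclusion (LinearMap.ker_le_ker_comp T S)
  set f₂ : LinearMap.ker (S ∘ₗ T) →ₗ[K] LinearMap.ker S :=
    (T.domRestrict _).codRestrict _ (fun x => x.2)
  set f₃ : LinearMap.ker S →ₗ[K] V ⧸ LinearMap.range T :=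
    (LinearMap.range T).mkQ.domRestrict _
  set f₄ : (V ⧸ LinearMap.range T) →ₗ[K] V ⧸ LinearMap.range (S ∘ₗ T) :=
    Submodule.mapQ _ _ S (by rintro _ ⟨x, rfl⟩; exact ⟨x, rfl⟩)
  set f₅ : (V ⧸ LinearMap.range (S ∘ₗ T)) →ₗ[K] V ⧸ LinearMap.range S :=
    Submodule.factor (LinearMap.range_comp_le_range T S)
  have h₁ : LinearMap.ker f₁ = ⊥ := LinearMap.ker_eq_bot.2 (Submodule.inclusion_injective _)
  have h₂ : LinearMap.ker f₂ = LinearMap.range f₁ := by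
    ext ⟨x, hx⟩
    simp only [LinearMap.mem_ker, LinearMap.mem_range, f₁, f₂]
    constructor
    · intro h
      exact ⟨⟨x, congrArg Subtype.val h⟩, rfl⟩
    · rintro ⟨⟨y, hy⟩, h⟩
      have : y = x := congrArg Subtype.val h
      subst this
      exact Subtype.ext hy
  have h₃ : LinearMap.ker f₃ = LinearMap.range f₂ := by
    ext ⟨x, hx⟩
    simp only [LinearMap.mem_ker, LinearMap.mem_range, f₂, f₃, LinearMap.domRestrict_apply,
      Submodule.mkQ_apply, Submodule.Quotient.mk_eq_zero]
    constructor
    · rintro ⟨y, rfl⟩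
      exact ⟨⟨y, hx⟩, rfl⟩
    · rintro ⟨⟨y, hy⟩, h⟩
      exact ⟨y, congrArg Subtype.val h⟩
  have h₄ : LinearMap.ker f₄ = LinearMap.range f₃ := by
    ext x
    obtain ⟨x, rfl⟩ := Submodule.mkQ_surjective _ x
    simp only [LinearMap.mem_ker, LinearMap.mem_range, f₃, f₄, Submodule.mkQ_apply,
      Submodule.mapQ_apply, Submodule.Quotient.mk_eq_zero]
    constructor
    · rintro ⟨y, hy⟩
      refine ⟨⟨x - T y, ?_⟩, ?_⟩
      · rw [LinearMap.mem_ker, map_sub, ← hy, LinearMap.comp_apply, sub_self]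
      · refine (Submodule.Quotient.eq _).2 ⟨-y, ?_⟩
        simp
    · rintro ⟨⟨y, hy⟩, h⟩
      obtain ⟨z, hz⟩ := (Submodule.Quotient.eq _).1 h
      refine ⟨-z, ?_⟩
      rw [LinearMap.comp_apply, map_neg, hz]
      simp [LinearMap.mem_ker.1 hy]
  have h₅ : LinearMap.ker f₅ = LinearMap.range f₄ := by
    ext x
    obtain ⟨x, rfl⟩ := Submodule.mkQ_surjective _ x
    have hx : f₅ ((LinearMap.range (S ∘ₗ T)).mkQ x) = (LinearMap.range S).mkQ x := rfl
    rw [LinearMap.mem_ker, hx, Submodule.mkQ_apply, Submodule.Quotient.mk_eq_zero,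
      LinearMap.mem_range]
    constructor
    · rintro ⟨y, rfl⟩
      exact ⟨Submodule.Quotient.mk y, rfl⟩
    · rintro ⟨y, h⟩
      obtain ⟨y, rfl⟩ := Submodule.mkQ_surjective _ y
      obtain ⟨z, hz⟩ := (Submodule.Quotient.eq _).1 h
      refine ⟨y - T z, ?_⟩
      rw [map_sub]
      rw [LinearMap.comp_apply] at hz
      rw [hz]
      abel
  have h₆ : LinearMap.range f₅ = ⊤ := LinearMap.range_eq_top.2 (Submodule.factor_surjective _)
  have e₁ := LinearMap.rank_range_add_rank_ker f₁
  have e₂ := LinearMap.rank_range_add_rank_ker f₂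
  have e₃ := LinearMap.rank_range_add_rank_ker f₃
  have e₄ := LinearMap.rank_range_add_rank_ker f₄
  have e₅ := LinearMap.rank_range_add_rank_ker f₅
  rw [h₁, rank_bot, add_zero] at e₁
  rw [h₂, add_comm] at e₂
  rw [h₃, add_comm] at e₃
  rw [h₄, add_comm] at e₄
  rw [h₅, h₆, rank_top, add_comm] at e₅
  exact ⟨_, _, _, _, _, e₁.symm, e₂.symm, e₃.symm, e₄.symm, e₅.symm, rfl⟩

variable {X : Type*} [NormedAddCommGroup X] [NormedSpace ℂ X]

theorem exists_nullity_defect_mul (S T : X →L[ℂ] X) :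
    ∃ r₁ r₂ r₃ r₄ r₅ : ℕ∞, nullity T = r₁ ∧ nullity (S * T) = r₁ + r₂ ∧ nullity S = r₂ + r₃ ∧
      defect T = r₃ + r₄ ∧ defect (S * T) = r₄ + r₅ ∧ defect S = r₅ := by
  obtain ⟨r₁, r₂, r₃, r₄, r₅, h₁, h₂, h₃, h₄, h₅, h₆⟩ :=
    exists_rank_ker_rank_coker_comp (S : X →ₗ[ℂ] X) (T : X →ₗ[ℂ] X)
  refine ⟨Cardinal.toENat r₁, Cardinal.toENat r₂, Cardinal.toENat r₃, Cardinal.toENat r₄,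
    Cardinal.toENat r₅, congrArg _ h₁, ?_, ?_, ?_, ?_, congrArg _ h₆⟩ <;> rw [← map_add]
  exacts [congrArg _ h₂, congrArg _ h₃, congrArg _ h₄, congrArg _ h₅]

/-- Additivity of the index, arranged so that no infinite value is subtracted. -/
theorem nullity_add_nullity_add_defect (S T : X →L[ℂ] X) :
    nullity T + nullity S + defect (S * T) = nullity (S * T) + defect T + defect S := by
  obtain ⟨r₁, r₂, r₃, r₄, r₅, h₁, h₂, h₃, h₄, h₅, h₆⟩ := exists_nullity_defect_mul S T
  rw [h₁, h₂, h₃, h₄, h₅, h₆]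
  ring

theorem nullity_le_nullity_mul (S T : X →L[ℂ] X) : nullity T ≤ nullity (S * T) := by
  obtain ⟨r₁, r₂, r₃, r₄, r₅, h₁, h₂, h₃, h₄, h₅, h₆⟩ := exists_nullity_defect_mul S T
  rw [h₁, h₂]
  exact le_self_add

theorem defect_le_defect_mul (S T : X →L[ℂ] X) : defect S ≤ defect (S * T) := by
  obtain ⟨r₁, r₂, r₃, r₄, r₅, h₁, h₂, h₃, h₄, h₅, h₆⟩ := exists_nullity_defect_mul S T
  rw [h₅, h₆]
  exact le_add_self

theorem nullity_mul_le (S T : X →L[ℂ] X) : nullity (S * T) ≤ nullity T + nullity S := by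
  obtain ⟨r₁, r₂, r₃, r₄, r₅, h₁, h₂, h₃, h₄, h₅, h₆⟩ := exists_nullity_defect_mul S T
  rw [h₁, h₂, h₃]
  gcongr
  exact le_self_add

theorem defect_mul_le (S T : X →L[ℂ] X) : defect (S * T) ≤ defect T + defect S := by
  obtain ⟨r₁, r₂, r₃, r₄, r₅, h₁, h₂, h₃, h₄, h₅, h₆⟩ := exists_nullity_defect_mul S T
  rw [h₄, h₅, h₆]
  gcongr
  exact le_add_self

theorem toEReal_natCast_sub_natCast (m n : ℕ) :
    ((((m : ℕ∞) : ℝ≥0∞) : EReal) - (((n : ℕ∞) : ℝ≥0∞) : EReal)) = ((m - n : ℝ) : EReal) := by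
  rw [ENat.toENNReal_coe, ENat.toENNReal_coe, EReal.coe_sub]
  rfl

theorem toEReal_natCast_sub_top (m : ℕ) :
    ((((m : ℕ∞) : ℝ≥0∞) : EReal) - (((⊤ : ℕ∞) : ℝ≥0∞) : EReal)) = ⊥ := by
  simp [sub_eq_add_neg]

theorem toEReal_top_sub_natCast (m : ℕ) :
    ((((⊤ : ℕ∞) : ℝ≥0∞) : EReal) - (((m : ℕ∞) : ℝ≥0∞) : EReal)) = ⊤ := by
  rw [ENat.toENNReal_top, EReal.coe_ennreal_top, ENat.toENNReal_coe]
  exact EReal.top_sub_coe m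

/-- The hypothesis `hfin` keeps all three differences in `ℝ ∪ {⊥}` or all three in `ℝ ∪ {⊤}`, so the
convention for `⊤ + ⊥` never intervenes. -/
theorem toEReal_sub_toEReal_add {a b c d e f : ℕ∞} (h : a + b + f = c + d + e)
    (hfin : (a ≠ ⊤ ∧ b ≠ ⊤ ∧ c ≠ ⊤) ∨ (d ≠ ⊤ ∧ e ≠ ⊤ ∧ f ≠ ⊤)) :
    (((c : ℝ≥0∞) : EReal) - ((f : ℝ≥0∞) : EReal)) =
      (((b : ℝ≥0∞) : EReal) - ((e : ℝ≥0∞) : EReal)) +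
        (((a : ℝ≥0∞) : EReal) - ((d : ℝ≥0∞) : EReal)) := by
  have finite : ∀ a b c d e f : ℕ, (a + b + f : ℕ∞) = c + d + e →
      (c - f : ℝ) = (b - e : ℝ) + (a - d : ℝ) := fun a b c d e f h => by
    have h' : (a + b + f : ℝ) = c + d + e := by exact_mod_cast h
    linarith
  have not_top : ∀ {x y : ℕ∞} {m n k : ℕ}, (m + n + x : ℕ∞) = k + y → y = ⊤ → x = ⊤ := by
    rintro x y m n k h rfl
    by_contra hx
    lift x to ℕ using hx
    rw [add_top] at h
    exact ENat.natCast_ne_top (m + n + x) (by exact_mod_cast h)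
  rcases hfin with ⟨ha, hb, hc⟩ | ⟨hd, he, hf⟩
  · lift a to ℕ using ha
    lift b to ℕ using hb
    lift c to ℕ using hc
    rw [add_assoc (c : ℕ∞)] at h
    by_cases hde : d = ⊤ ∨ e = ⊤
    · have hf : f = ⊤ := not_top h (by rcases hde with rfl | rfl <;> simp)
      rw [hf, toEReal_natCast_sub_top]
      rcases hde with rfl | rfl <;> simp
    · push Not at hde
      lift d to ℕ using hde.1
      lift e to ℕ using hde.2
      have hf : f ≠ ⊤ := by
        rintro rfl
        rw [add_top] at h
        exact ENat.natCast_ne_top (c + (d + e)) (by exact_mod_cast h.symm)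
      lift f to ℕ using hf
      rw [← add_assoc] at h
      simp only [toEReal_natCast_sub_natCast, ← EReal.coe_add, finite a b c d e f h]
  · lift d to ℕ using hd
    lift e to ℕ using he
    lift f to ℕ using hf
    by_cases hab : a = ⊤ ∨ b = ⊤
    · have hc : c = ⊤ := not_top (m := d) (n := e) (k := f) (x := c) (y := a + b)
        (by rw [add_comm (f : ℕ∞), h]; ring) (by rcases hab with rfl | rfl <;> simp)
      rw [hc, toEReal_top_sub_natCast]
      rcases hab with rfl | rfl
      · rw [toEReal_top_sub_natCast]
        induction b using ENat.recTopCoe with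
        | top => simp
        | coe b => rw [toEReal_natCast_sub_natCast, EReal.coe_add_top]
      · rw [toEReal_top_sub_natCast]
        induction a using ENat.recTopCoe with
        | top => simp
        | coe a => rw [toEReal_natCast_sub_natCast, EReal.top_add_coe]
    · push Not at hab
      lift a to ℕ using hab.1
      lift b to ℕ using hab.2
      have hc : c ≠ ⊤ := by
        rintro rfl
        rw [top_add, top_add] at h
        exact ENat.natCast_ne_top (a + b + f) (by exact_mod_cast h)
      lift c to ℕ using hc
      simp only [toEReal_natCast_sub_natCast, ← EReal.coe_add, finite a b c d e f h]

/-- The logarithmic law of the index, for operators with finite nullities. -/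
theorem semiFredholmIndex_mul_of_nullity {S T : X →L[ℂ] X} (hS : nullity S ≠ ⊤)
    (hT : nullity T ≠ ⊤) :
    nullity (S * T) ≠ ⊤ ∧
      semiFredholmIndex (S * T) = semiFredholmIndex S + semiFredholmIndex T := by
  have hST : nullity (S * T) ≠ ⊤ :=
    ne_top_of_le_ne_top (WithTop.add_ne_top.2 ⟨hT, hS⟩) (nullity_mul_le S T)
  exact ⟨hST, toEReal_sub_toEReal_add (nullity_add_nullity_add_defect S T) (.inl ⟨hT, hS, hST⟩)⟩

/-- The logarithmic law of the index, for operators with finite defects. -/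
theorem semiFredholmIndex_mul_of_defect {S T : X →L[ℂ] X} (hS : defect S ≠ ⊤)
    (hT : defect T ≠ ⊤) :
    defect (S * T) ≠ ⊤ ∧
      semiFredholmIndex (S * T) = semiFredholmIndex S + semiFredholmIndex T := by
  have hST : defect (S * T) ≠ ⊤ :=
    ne_top_of_le_ne_top (WithTop.add_ne_top.2 ⟨hT, hS⟩) (defect_mul_le S T)
  exact ⟨hST, toEReal_sub_toEReal_add (nullity_add_nullity_add_defect S T) (.inr ⟨hT, hS, hST⟩)⟩

/-- The index of a quotient: if `B * T` has equal finite nullity and defect, then the index of `T`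
is the opposite of the index of `B`. -/
theorem semiFredholmIndex_eq_neg {B T : X →L[ℂ] X} (h : nullity (B * T) ≠ ⊤)
    (h' : nullity (B * T) = defect (B * T)) :
    nullity T ≠ ⊤ ∧ defect B ≠ ⊤ ∧ semiFredholmIndex T = -semiFredholmIndex B ∧
      semiFredholmIndex B = -semiFredholmIndex T := by
  have hT := ne_top_of_le_ne_top h (nullity_le_nullity_mul B T)
  have hB := ne_top_of_le_ne_top (h' ▸ h) (defect_le_defect_mul B T)
  have key := nullity_add_nullity_add_defect B T
  rw [← h'] at key
  have key' : nullity T + nullity B = defect T + defect B := by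
    -- The common value `nullity (B * T)` is finite and cancels; `nullity B` and `defect T` may
    -- still both be infinite.
    rw [add_comm, add_assoc] at key
    exact ENat.add_right_injective_of_ne_top h key
  have main : semiFredholmIndex T = -semiFredholmIndex B := by
    unfold semiFredholmIndex
    revert key' hT hB
    generalize nullity T = a, nullity B = b, defect T = c, defect B = d
    intro hT hB key
    lift a to ℕ using hT
    lift d to ℕ using hB
    induction b using ENat.recTopCoe with
    | top =>
      have hc : c = ⊤ := by
        by_contra hc
        lift c to ℕ using hc
        rw [add_top] at key
        exact ENat.natCast_ne_top (c + d) (by exact_mod_cast key.symm)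
      rw [hc, toEReal_natCast_sub_top, toEReal_top_sub_natCast, EReal.neg_top]
    | coe b =>
      have hc : c ≠ ⊤ := by
        rintro rfl
        rw [top_add] at key
        exact ENat.natCast_ne_top (a + b) (by exact_mod_cast key)
      lift c to ℕ using hc
      have h' : (a + b : ℝ) = c + d := by exact_mod_cast key
      rw [toEReal_natCast_sub_natCast, toEReal_natCast_sub_natCast, ← EReal.coe_neg]
      congr 1
      linarith
  exact ⟨hT, hB, main, by rw [main, neg_neg]⟩

theorem semiFredholmIndex_eq_coe {T : X →L[ℂ] X} (h : nullity T ≠ ⊤) (h' : defect T ≠ ⊤) :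
    ∃ n : ℝ, semiFredholmIndex T = n := by
  unfold semiFredholmIndex
  lift nullity T to ℕ using h with a
  lift defect T to ℕ using h' with b
  exact ⟨a - b, toEReal_natCast_sub_natCast a b⟩

end Index

/-! ### Riesz theory: compact perturbations of the identity have index zero. -/

section Riesz

variable {X : Type*} [NormedAddCommGroup X] [NormedSpace ℂ X]

theorem nullity_ne_top_iff {T : X →L[ℂ] X} :
    nullity T ≠ ⊤ ↔ FiniteDimensional ℂ (LinearMap.ker (T : X →ₗ[ℂ] X)) := by
  rw [nullity, Ne, Cardinal.toENat_eq_top, not_le]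
  exact Module.rank_lt_aleph0_iff

/-- The kernel of a compact perturbation of the identity is finite-dimensional. -/
theorem finiteDimensional_ker_one_add {K : X →L[ℂ] X} (hK : IsCompactOperator K) :
    FiniteDimensional ℂ (LinearMap.ker ((1 + K : X →L[ℂ] X) : X →ₗ[ℂ] X)) := by
  set N := LinearMap.ker ((1 + K : X →L[ℂ] X) : X →ₗ[ℂ] X)
  have hN : IsClosed (N : Set X) := (1 + K).isClosed_ker
  have hx : ∀ x ∈ N, K x = -x := fun x hx => by
    have : x + K x = 0 := hx
    exact (neg_eq_of_add_eq_zero_right this).symm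
  have hKN : Set.MapsTo (K : X →ₗ[ℂ] X) N N := fun x hx' => by
    change K x ∈ N
    rw [hx x hx']
    exact N.neg_mem hx'
  -- `K` acts as `-1` on the kernel, so the identity of this closed subspace is compact.
  refine FiniteDimensional.of_isCompactOperator_id (𝕜 := ℂ) ?_
  have hid : (id : N → N) = -⇑((K : X →ₗ[ℂ] X).restrict hKN) :=
    funext fun x => Subtype.ext (by
      change (x : X) = -K x
      rw [hx x x.2, neg_neg])
  rw [hid]
  exact (hK.restrict hKN hN).neg

variable [CompleteSpace X]

/-- The Fredholm alternative. -/
theorem bijective_one_add_of_injective {K : X →L[ℂ] X} (hK : IsCompactOperator K)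
    (h : Function.Injective (1 + K : X →L[ℂ] X)) :
    Function.Bijective (1 + K : X →L[ℂ] X) := by
  rw [← ContinuousLinearMap.isUnit_iff_bijective]
  rcases hK.hasEigenvalue_or_mem_resolventSet (μ := -1) (by norm_num) with hev | hres
  · obtain ⟨x, hx⟩ := hev.exists_hasEigenvector
    refine absurd (h (a₁ := x) (a₂ := 0) ?_) hx.2
    have : K x = (-1 : ℂ) • x := hx.apply_eq_smul
    simp [this]
  · rw [spectrum.mem_resolventSet_iff, ← IsUnit.neg_iff] at hres
    convert hres using 1
    simp [sub_eq_add_neg, add_comm]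

/-- The dual Fredholm alternative. -/
theorem injective_one_add_of_surjective {K : X →L[ℂ] X} (hK : IsCompactOperator K)
    (h : Function.Surjective (1 + K : X →L[ℂ] X)) :
    Function.Injective (1 + K : X →L[ℂ] X) := by
  have := finiteDimensional_ker_one_add hK
  obtain ⟨M, hM, hNM⟩ := (Submodule.ClosedComplemented.of_finiteDimensional
    (𝕜 := ℂ) (LinearMap.ker ((1 + K : X →L[ℂ] X) : X →ₗ[ℂ] X))).exists_isClosed_isCompl
  have : CompleteSpace M := hM.completeSpace_coe
  set R : M →L[ℂ] X := (1 + K) ∘L M.subtypeL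
  have hR : Function.Bijective R := by
    constructor
    · refine (injective_iff_map_eq_zero R).2 fun x hx => ?_
      exact Subtype.ext (hNM.disjoint.le_bot ⟨hx, x.2⟩)
    · intro y
      obtain ⟨x, rfl⟩ := h y
      obtain ⟨n, hn, m, hm, rfl⟩ := Submodule.mem_sup.1
        (hNM.sup_eq_top ▸ Submodule.mem_top : x ∈ _ ⊔ M)
      refine ⟨⟨m, hm⟩, ?_⟩
      rw [map_add, show (1 + K) n = 0 from hn, zero_add]
      rfl
  set e := ContinuousLinearEquiv.ofBijective R (LinearMap.ker_eq_bot.2 hR.1)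
    (LinearMap.range_eq_top.2 hR.2)
  set G : X →L[ℂ] X := M.subtypeL ∘L (e.symm : X →L[ℂ] M)
  have hG : ∀ x, (1 + K) (G x) = x := fun x => e.apply_symm_apply x
  -- The right inverse `G` is itself a compact perturbation of the identity. Being injective, it is
  -- bijective, which makes `1 + K` its inverse; no adjoint is needed.
  have hGK : G = 1 + -(K * G) := by
    ext x
    have : G x + K (G x) = x := hG x
    exact eq_add_neg_of_add_eq this
  have hGs : Function.Surjective G := by
    rw [hGK]
    refine (bijective_one_add_of_injective (hK.comp_clm G).neg ?_).2
    rw [← hGK]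
    exact Function.LeftInverse.injective hG
  intro x y hxy
  obtain ⟨x, rfl⟩ := hGs x
  obtain ⟨y, rfl⟩ := hGs y
  rw [hG, hG] at hxy
  rw [hxy]

/-- A compact perturbation of the identity has index zero. -/
theorem nullity_one_add_eq_defect {K : X →L[ℂ] X} (hK : IsCompactOperator K) :
    nullity (1 + K) ≠ ⊤ ∧ nullity (1 + K) = defect (1 + K) := by
  have hfin := finiteDimensional_ker_one_add hK
  refine ⟨nullity_ne_top_iff.2 hfin, ?_⟩
  set T : X →L[ℂ] X := 1 + K with hT
  set N := LinearMap.ker (T : X →ₗ[ℂ] X)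
  set Q := X ⧸ LinearMap.range (T : X →ₗ[ℂ] X)
  obtain ⟨π, hπ⟩ := Submodule.ClosedComplemented.of_finiteDimensional (𝕜 := ℂ) N
  -- The range is not known to be closed, so `s` is only an algebraic section; `s ∘ₗ j` is
  -- continuous because `N` is finite-dimensional.
  obtain ⟨s, hs⟩ := (LinearMap.range (T : X →ₗ[ℂ] X)).mkQ.exists_rightInverse_of_surjective
    (Submodule.range_mkQ _)
  have hs' : ∀ q, (LinearMap.range (T : X →ₗ[ℂ] X)).mkQ (s q) = q := fun q =>
    LinearMap.congr_fun hs q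
  have hTQ : ∀ x, (LinearMap.range (T : X →ₗ[ℂ] X)).mkQ (T x) = 0 := fun x =>
    (Submodule.Quotient.mk_eq_zero _).2 ⟨x, rfl⟩
  -- The finite rank perturbation of `T` by a linear map from its kernel to its cokernel.
  let F (j : N →ₗ[ℂ] Q) : X →L[ℂ] X := (LinearMap.toContinuousLinearMap (s ∘ₗ j)) ∘L π
  have hF : ∀ j x, F j x = s (j (π x)) := fun j x => rfl
  have hFc : ∀ j, IsCompactOperator (K + F j : X →L[ℂ] X) := fun j =>
    have : ProperSpace N := FiniteDimensional.proper ℂ N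
    hK.add ((isCompactOperator_of_locallyCompactSpace_rng
      (LinearMap.toContinuousLinearMap (s ∘ₗ j))).comp_clm π)
  have inj : ∀ j : N →ₗ[ℂ] Q, Function.Injective j → Function.Injective (1 + (K + F j) : X →L[ℂ] X) := by
    intro j hj
    rw [← add_assoc, ← hT]
    refine (injective_iff_map_eq_zero _).2 fun x hx => ?_
    have hx' : T x + s (j (π x)) = 0 := hx
    have h₀ : j (π x) = 0 := by
      have := congrArg (LinearMap.range (T : X →ₗ[ℂ] X)).mkQ hx'
      rwa [map_add, hTQ, hs', zero_add, map_zero] at this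
    have hTx : T x = 0 := by simpa [h₀] using hx'
    have : π x = ⟨x, hTx⟩ := hπ ⟨x, hTx⟩
    rw [this, ← map_zero j] at h₀
    exact congrArg Subtype.val (hj h₀)
  have inj' : ∀ j : N →ₗ[ℂ] Q, Function.Injective (1 + (K + F j) : X →L[ℂ] X) → Function.Injective j := by
    intro j hj
    rw [← add_assoc, ← hT] at hj
    refine (injective_iff_map_eq_zero _).2 fun x hx => ?_
    have h₀ : (T + F j) x = 0 := by
      change T x + s (j (π x)) = 0
      rw [hπ x, hx, map_zero, add_zero]
      exact x.2
    exact Subtype.ext (hj (h₀.trans (map_zero _).symm))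
  have surj : ∀ j : N →ₗ[ℂ] Q, Function.Surjective j → Function.Surjective (1 + (K + F j) : X →L[ℂ] X) := by
    intro j hj y
    rw [← add_assoc, ← hT]
    obtain ⟨n, hn⟩ := hj ((LinearMap.range (T : X →ₗ[ℂ] X)).mkQ y)
    have : y - s (j n) ∈ LinearMap.range (T : X →ₗ[ℂ] X) := by
      rw [← Submodule.Quotient.mk_eq_zero, ← Submodule.mkQ_apply, map_sub, hs', hn, sub_self]
    obtain ⟨x, hx⟩ := this
    refine ⟨x - π x + n, ?_⟩
    change T (x - π x + n) + s (j (π (x - π x + n))) = y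
    have h₁ : T (π x) = 0 := (π x).2
    have h₂ : T n = 0 := n.2
    have h₃ : T x = y - s (j n) := hx
    rw [map_add, map_sub, map_add, map_sub, hπ, hπ, h₁, h₂, h₃, sub_self, zero_add]
    abel
  have surj' : ∀ j : N →ₗ[ℂ] Q, Function.Surjective (1 + (K + F j) : X →L[ℂ] X) → Function.Surjective j := by
    intro j hj q
    obtain ⟨y, rfl⟩ := Submodule.mkQ_surjective _ q
    rw [← add_assoc, ← hT] at hj
    obtain ⟨x, rfl⟩ := hj y
    refine ⟨π x, ?_⟩
    change _ = (LinearMap.range (T : X →ₗ[ℂ] X)).mkQ (T x + s (j (π x)))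
    rw [map_add, hTQ, hs', zero_add]
  have bij : ∀ j : N →ₗ[ℂ] Q, Function.Bijective j → Module.rank ℂ N = Module.rank ℂ Q :=
    fun j hj => (LinearEquiv.ofBijective j hj).rank_eq
  refine congrArg Cardinal.toENat (?_ : Module.rank ℂ N = Module.rank ℂ Q)
  -- Comparing cardinals gives an injective or a surjective `j`. The Fredholm alternative for `T + F
  -- j` then makes `j` bijective, although `Q` is not known beforehand to be finite-dimensional.
  rcases le_total (Module.rank ℂ N) (Module.rank ℂ Q) with hle | hle
  · obtain ⟨j, hj⟩ := rank_le_iff_exists_linearMap.1 hle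
    exact bij j ⟨hj, surj' j (bijective_one_add_of_injective (hFc j) (inj j hj)).2⟩
  · obtain ⟨i, hi⟩ := rank_le_iff_exists_linearMap.1 hle
    obtain ⟨j, hj⟩ := i.exists_leftInverse_of_injective (LinearMap.ker_eq_bot.2 hi)
    have hj : Function.Surjective j := fun q => ⟨i q, LinearMap.congr_fun hj q⟩
    exact bij j ⟨inj' j (injective_one_add_of_surjective (hFc j) (surj j hj)), hj⟩

end Riesz

/-! ### The index as a function on semi-invertible classes of the Calkin algebra. -/

section CalkinIndex

variable {X : Type*} [NormedAddCommGroup X] [NormedSpace ℂ X]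

theorem calkinMap_eq_iff {S T : X →L[ℂ] X} :
    calkinMap S = calkinMap T ↔ IsCompactOperator (S - T : X →L[ℂ] X) :=
  Ideal.Quotient.eq

theorem calkinMap_surjective : Function.Surjective (calkinMap : (X →L[ℂ] X) →+* Calkin X) :=
  Ideal.Quotient.mk_surjective

/-- `T` has a left or a right inverse modulo the compact operators. -/
def IsSemiInvertible (T : X →L[ℂ] X) : Prop :=
  (∃ b, b * calkinMap T = 1) ∨ ∃ b, calkinMap T * b = 1

theorem IsSemiInvertible.of_isUnit {T : X →L[ℂ] X} (h : IsUnit (calkinMap T)) :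
    IsSemiInvertible T :=
  .inl h.exists_left_inv

theorem IsSemiInvertible.unit_mul {U T : X →L[ℂ] X} (hT : IsSemiInvertible T)
    (hU : IsUnit (calkinMap U)) : IsSemiInvertible (U * T) := by
  obtain ⟨v, hv⟩ := hU.exists_left_inv
  obtain ⟨w, hw⟩ := hU.exists_right_inv
  rcases hT with ⟨b, hb⟩ | ⟨b, hb⟩
  · refine .inl ⟨b * v, ?_⟩
    rw [map_mul, mul_assoc, ← mul_assoc v, hv, one_mul, hb]
  · refine .inr ⟨b * w, ?_⟩
    rw [map_mul, mul_assoc, ← mul_assoc _ b, hb, one_mul, hw]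

variable [CompleteSpace X]

theorem nullity_eq_defect_of_calkinMap_eq_one {T : X →L[ℂ] X} (h : calkinMap T = 1) :
    nullity T ≠ ⊤ ∧ nullity T = defect T := by
  rw [← map_one calkinMap, calkinMap_eq_iff] at h
  have := nullity_one_add_eq_defect h
  rwa [add_sub_cancel] at this

theorem semiFredholmIndex_eq_neg_of_calkinMap {B T : X →L[ℂ] X}
    (h : calkinMap B * calkinMap T = 1) :
    nullity T ≠ ⊤ ∧ defect B ≠ ⊤ ∧ semiFredholmIndex T = -semiFredholmIndex B ∧
      semiFredholmIndex B = -semiFredholmIndex T := by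
  rw [← map_mul] at h
  obtain ⟨h₁, h₂⟩ := nullity_eq_defect_of_calkinMap_eq_one h
  exact semiFredholmIndex_eq_neg h₁ h₂

theorem nullity_ne_top_of_left_inv {T : X →L[ℂ] X} (h : ∃ b, b * calkinMap T = 1) :
    nullity T ≠ ⊤ := by
  obtain ⟨b, hb⟩ := h
  obtain ⟨B, rfl⟩ := calkinMap_surjective b
  exact (semiFredholmIndex_eq_neg_of_calkinMap hb).1

theorem defect_ne_top_of_right_inv {T : X →L[ℂ] X} (h : ∃ b, calkinMap T * b = 1) :
    defect T ≠ ⊤ := by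
  obtain ⟨b, hb⟩ := h
  obtain ⟨B, rfl⟩ := calkinMap_surjective b
  exact (semiFredholmIndex_eq_neg_of_calkinMap hb).2.1

theorem IsSemiInvertible.nullity_ne_top_or_defect_ne_top {T : X →L[ℂ] X}
    (h : IsSemiInvertible T) : nullity T ≠ ⊤ ∨ defect T ≠ ⊤ :=
  h.imp nullity_ne_top_of_left_inv defect_ne_top_of_right_inv

/-- The index of a semi-Fredholm operator only depends on its class in the Calkin algebra. -/
theorem IsSemiInvertible.semiFredholmIndex_congr {S T : X →L[ℂ] X} (hS : IsSemiInvertible S)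
    (h : calkinMap S = calkinMap T) : semiFredholmIndex S = semiFredholmIndex T := by
  rcases hS with ⟨b, hb⟩ | ⟨b, hb⟩ <;> obtain ⟨B, rfl⟩ := calkinMap_surjective b
  -- The same `B` inverts both classes on the same side, so both indices are the opposite of that of
  -- `B`.
  · rw [(semiFredholmIndex_eq_neg_of_calkinMap hb).2.2.1]
    rw [h] at hb
    exact (semiFredholmIndex_eq_neg_of_calkinMap hb).2.2.1.symm
  · rw [(semiFredholmIndex_eq_neg_of_calkinMap hb).2.2.2]
    rw [h] at hb
    exact (semiFredholmIndex_eq_neg_of_calkinMap hb).2.2.2.symm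

theorem semiFredholmIndex_mul_of_left_inv {S T : X →L[ℂ] X} (hS : ∃ b, b * calkinMap S = 1)
    (hT : ∃ b, b * calkinMap T = 1) :
    semiFredholmIndex (S * T) = semiFredholmIndex S + semiFredholmIndex T :=
  (semiFredholmIndex_mul_of_nullity (nullity_ne_top_of_left_inv hS)
    (nullity_ne_top_of_left_inv hT)).2

theorem semiFredholmIndex_mul_of_right_inv {S T : X →L[ℂ] X} (hS : ∃ b, calkinMap S * b = 1)
    (hT : ∃ b, calkinMap T * b = 1) :
    semiFredholmIndex (S * T) = semiFredholmIndex S + semiFredholmIndex T :=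
  (semiFredholmIndex_mul_of_defect (defect_ne_top_of_right_inv hS)
    (defect_ne_top_of_right_inv hT)).2

theorem IsSemiInvertible.semiFredholmIndex_unit_mul {U T : X →L[ℂ] X}
    (hU : IsUnit (calkinMap U)) (hT : IsSemiInvertible T) :
    semiFredholmIndex (U * T) = semiFredholmIndex U + semiFredholmIndex T :=
  hT.elim (semiFredholmIndex_mul_of_left_inv hU.exists_left_inv)
    (semiFredholmIndex_mul_of_right_inv hU.exists_right_inv)

theorem IsSemiInvertible.semiFredholmIndex_mul_unit {U T : X →L[ℂ] X}
    (hU : IsUnit (calkinMap U)) (hT : IsSemiInvertible T) :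
    semiFredholmIndex (T * U) = semiFredholmIndex T + semiFredholmIndex U :=
  hT.elim (fun h => semiFredholmIndex_mul_of_left_inv h hU.exists_left_inv)
    (fun h => semiFredholmIndex_mul_of_right_inv h hU.exists_right_inv)

theorem exists_semiFredholmIndex_eq_coe {U : X →L[ℂ] X} (hU : IsUnit (calkinMap U)) :
    ∃ n : ℝ, semiFredholmIndex U = n :=
  semiFredholmIndex_eq_coe (nullity_ne_top_of_left_inv hU.exists_left_inv)
    (defect_ne_top_of_right_inv hU.exists_right_inv)

/-- The index is invariant under similarity in the Calkin algebra. -/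
theorem IsSemiInvertible.semiFredholmIndex_eq_of_mul_eq {S T U : X →L[ℂ] X}
    (hS : IsSemiInvertible S) (hT : IsSemiInvertible T) (hU : IsUnit (calkinMap U))
    (h : calkinMap U * calkinMap T = calkinMap S * calkinMap U) :
    semiFredholmIndex S = semiFredholmIndex T := by
  have key := (hT.unit_mul hU).semiFredholmIndex_congr (T := S * U) (by rw [map_mul, map_mul, h])
  rw [hT.semiFredholmIndex_unit_mul hU, hS.semiFredholmIndex_mul_unit hU] at key
  -- The index of `U` is a real number, hence cancellable in `EReal`.
  obtain ⟨n, hn⟩ := exists_semiFredholmIndex_eq_coe hU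
  rw [hn, add_comm _ (n : EReal)] at key
  exact ((EReal.addLECancellable_coe n).inj.1 key).symm

/-- An invertible operator has index zero. -/
theorem semiFredholmIndex_of_isUnit {T : X →L[ℂ] X} (h : IsUnit T) :
    semiFredholmIndex T = 0 := by
  have hb := ContinuousLinearMap.isUnit_iff_bijective.1 h
  have h₁ : nullity T = 0 := by
    rw [nullity, LinearMap.ker_eq_bot.2 hb.1, rank_bot, map_zero]
  have h₂ : defect T = 0 := by
    rw [defect, LinearMap.range_eq_top.2 hb.2, rank_subsingleton', map_zero]
  simp [semiFredholmIndex, h₁, h₂]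

/-- The index is constant along a segment of Fredholm operators which starts at the identity. -/
theorem semiFredholmIndex_one_add_eq_zero {N : X →L[ℂ] X}
    (h : ∀ s : ℝ, IsUnit (calkinMap (1 + (s : ℂ) • N))) : semiFredholmIndex (1 + N) = 0 := by
  have hlc : IsLocallyConstant fun s : ℝ => semiFredholmIndex (1 + (s : ℂ) • N) := by
    refine (IsLocallyConstant.iff_eventually_eq _).2 fun s₀ => ?_
    obtain ⟨b, hb⟩ := (h s₀).exists_left_inv
    obtain ⟨B, rfl⟩ := calkinMap_surjective b
    have hB : IsUnit (calkinMap B) := by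
      obtain ⟨c, hc⟩ := (h s₀).exists_right_inv
      rw [← left_inv_eq_right_inv hb hc] at hc
      exact ⟨⟨_, _, hb, hc⟩, rfl⟩
    have hcont : Filter.Tendsto (fun s : ℝ => ((s₀ : ℂ) - s) • (B * N)) (nhds s₀) (nhds 0) := by
      have : Continuous (fun s : ℝ => ((s₀ : ℂ) - s) • (B * N)) := by fun_prop
      simpa using this.tendsto s₀
    -- Modulo compacts, `B (1 + s N)` is `1 - (s₀ - s) B N`, which is invertible for `s` near `s₀`
    -- and so has index zero.
    have key : ∀ᶠ s : ℝ in nhds s₀,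
        semiFredholmIndex B + semiFredholmIndex (1 + (s : ℂ) • N) = 0 := by
      filter_upwards [hcont.eventually (Metric.ball_mem_nhds 0 one_pos)] with s hs
      have hs' : ‖((s₀ : ℂ) - s) • (B * N)‖ < 1 := by simpa using hs
      have hu := isUnit_one_sub_of_norm_lt_one hs'
      rw [← semiFredholmIndex_of_isUnit hu,
        ← (IsSemiInvertible.of_isUnit (h s)).semiFredholmIndex_unit_mul hB]
      refine ((IsSemiInvertible.of_isUnit (hu.map calkinMap)).semiFredholmIndex_congr ?_).symm
      have : B * (1 + (s : ℂ) • N) =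
          B * (1 + (s₀ : ℂ) • N) - ((s₀ : ℂ) - s) • (B * N) := by
        rw [mul_add, mul_add, mul_smul_comm, mul_smul_comm, sub_smul]
        abel
      rw [this, map_sub, map_sub, map_mul, hb, map_one]
    filter_upwards [key] with s hs
    have hs₀ := key.self_of_nhds
    obtain ⟨n, hn⟩ := exists_semiFredholmIndex_eq_coe hB
    rw [← hs₀, hn] at hs
    exact (EReal.addLECancellable_coe n).inj.1 hs
  have := hlc.apply_eq_of_isPreconnected isPreconnected_univ (Set.mem_univ (1 : ℝ))
    (Set.mem_univ (0 : ℝ))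
  simp only [Complex.ofReal_one, one_smul, Complex.ofReal_zero, zero_smul, add_zero] at this
  rw [this, semiFredholmIndex_of_isUnit isUnit_one]

end CalkinIndex

/-! ### Ring identities for `p`-invertible elements. -/

section PInvertible

variable {A : Type*} [Ring A]

theorem exists_mul_inverse_commute {e p : A} (he : IsUnit e) (h : e * p = p * e) :
    ∃ w : A, w * e = 1 ∧ e * w = 1 ∧ w * p = p * w := by
  obtain ⟨u, rfl⟩ := he
  exact ⟨↑u⁻¹, u.inv_mul, u.mul_inv, ((show Commute (u : A) p from h).units_inv_left).eq⟩

theorem IsQuasinilpotent.isUnit_one_add {a : A} (ha : IsQuasinilpotent a) : IsUnit (1 + a) := by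
  have := ha (-1) (by simp)
  rwa [neg_one_mul, sub_neg_eq_add] at this

/-- A product of left `p`-invertible elements is left `p`-invertible if its `p`-part is
quasinilpotent. -/
theorem IsLeftPInvertible.mul {p s t : A} (hp : p * p = p) (hs : IsLeftPInvertible p s)
    (ht : IsLeftPInvertible p t) (hst : IsQuasinilpotent (p * (s * t))) :
    IsLeftPInvertible p (s * t) := by
  obtain ⟨hsp, b, hbp, hb⟩ := hs
  obtain ⟨htp, c, hcp, hc⟩ := ht
  have hstp : s * t * p = p * (s * t) := by rw [mul_assoc, htp, ← mul_assoc, hsp, mul_assoc]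
  obtain ⟨w, hw, -, hwp⟩ := exists_mul_inverse_commute (p := p) hst.isUnit_one_add (by
    linear_combination (norm := noncomm_ring) p * hstp)
  -- The inverse is assembled blockwise: on the `p` block `s t + p` acts as `1 + p s t`, inverted by
  -- `w`; on the complementary block it is `s t`, left inverted by `c b`.
  refine ⟨hstp, p * w + (1 - p) * (c * b), ?_, ?_⟩
  · have h : c * b * p = p * (c * b) := by rw [mul_assoc, hbp, ← mul_assoc, hcp, mul_assoc]
    linear_combination (norm := noncomm_ring) p * hwp + (1 - p) * h
  · have h₁ : p * w * (s * t + p) = p := by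
      linear_combination (norm := noncomm_ring)
        -hwp * (s * t + p) + hw * p + w * hp - w * p * hstp - w * hp * (s * t)
    have h₂ : b * s * (1 - p) = 1 - p := by
      linear_combination (norm := noncomm_ring) hb * (1 - p) + b * hp
    have h₃ : c * t * (1 - p) = 1 - p := by
      linear_combination (norm := noncomm_ring) hc * (1 - p) + c * hp
    have h₄ : (1 - p) * (c * b) * (s * t + p) = 1 - p := by
      linear_combination (norm := noncomm_ring)
        hcp * b * (s * t + p) + c * hbp * (s * t + p) - c * b * hp + c * h₂ * t + h₃
          + c * b * hsp * t + c * htp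
    rw [add_mul, h₁, h₄, add_sub_cancel]

/-- A product of right `p`-invertible elements is right `p`-invertible if its `p`-part is
quasinilpotent. -/
theorem IsRightPInvertible.mul {p s t : A} (hp : p * p = p) (hs : IsRightPInvertible p s)
    (ht : IsRightPInvertible p t) (hst : IsQuasinilpotent (p * (s * t))) :
    IsRightPInvertible p (s * t) := by
  obtain ⟨hsp, b, hbp, hb⟩ := hs
  obtain ⟨htp, c, hcp, hc⟩ := ht
  have hstp : s * t * p = p * (s * t) := by rw [mul_assoc, htp, ← mul_assoc, hsp, mul_assoc]
  obtain ⟨w, -, hw, hwp⟩ := exists_mul_inverse_commute (p := p) hst.isUnit_one_add (by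
    linear_combination (norm := noncomm_ring) p * hstp)
  refine ⟨hstp, p * w + (1 - p) * (c * b), ?_, ?_⟩
  · have h : c * b * p = p * (c * b) := by rw [mul_assoc, hbp, ← mul_assoc, hcp, mul_assoc]
    linear_combination (norm := noncomm_ring) p * hwp + (1 - p) * h
  · have h₁ : (s * t + p) * (p * w) = p := by
      linear_combination (norm := noncomm_ring) hp * w + hw * p + hstp * w - (1 + p * (s * t)) * hwp
        - p * hstp * w - hp * (s * t) * w
    have h₂ : s * (1 - p) * b = 1 - p := by
      linear_combination (norm := noncomm_ring) (1 - p) * hb + hp * b - hsp * b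
    have h₃ : t * (1 - p) * c = 1 - p := by
      linear_combination (norm := noncomm_ring) (1 - p) * hc + hp * c - htp * c
    have h₄ : (s * t + p) * ((1 - p) * (c * b)) = 1 - p := by
      linear_combination (norm := noncomm_ring) -hp * c * b + s * h₃ * b + h₂
    rw [mul_add, h₁, h₄, add_sub_cancel]

/-- The elements `s t + p` and `(s + p) (t + p)` differ by perturbations of the identity by the
`p`-parts of `s`, `t` and `s t`. -/
theorem one_add_mul_one_add_mul_eq {p s t : A} (hp : p * p = p) (hs : s * p = p * s)
    (ht : t * p = p * t) (hst : p * (s * t) = p * (t * s)) :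
    (1 + p * s) * ((1 + p * t) * (s * t + p)) =
      (1 + p * (s * t)) * ((s + p) * (t + p)) := by
  -- On the `1 - p` block both sides are `s t`. On the `p` block they are the same three factors in
  -- different orders, and the blocks of `s` and `t` there commute by `hab` and `hba`.
  have hab : p * s * (p * t) = p * (s * t) := by
    linear_combination (norm := noncomm_ring) p * hs * t + hp * s * t
  have hba : p * t * (p * s) = p * (s * t) := by
    linear_combination (norm := noncomm_ring) p * ht * s + hp * t * s - hst
  have h₁ : p * s * (s * t) = p * s * (p * s * (p * t)) := by
    linear_combination (norm := noncomm_ring) -p * s * hab - p * hs * s * t - hp * s * s * t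
  have h₂ : p * t * (s * t) = p * t * (p * s * (p * t)) := by
    linear_combination (norm := noncomm_ring) -p * t * hab - p * ht * s * t - hp * t * s * t
  have h₃ : p * s * p = p * s := by
    linear_combination (norm := noncomm_ring) p * hs + hp * s
  have h₄ : p * t * p = p * t := by
    linear_combination (norm := noncomm_ring) p * ht + hp * t
  have h₅ : (s + p) * (t + p) = s * t + p * s + p * t + p := by
    linear_combination (norm := noncomm_ring) hs + hp
  rw [← hab] at hba ⊢
  rw [h₅]
  linear_combination (norm := noncomm_ring)
    h₁ + h₂ + h₃ + h₄ - p * s * hba + hba * (p * t)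

end PInvertible

/-! ### Quasinilpotent elements of a Banach algebra and similarity of idempotents. -/

section BanachAlgebra

variable {A : Type*} [NormedRing A] [NormedAlgebra ℂ A] [CompleteSpace A]

/-- Taking scalars for `x` in the definition shows that the spectrum has no nonzero point; Gelfand's
formula turns this into norm decay. -/
theorem IsQuasinilpotent.eventually_norm_pow_le {a : A} (ha : IsQuasinilpotent a) {ε : ℝ}
    (hε : 0 < ε) : ∀ᶠ n : ℕ in Filter.atTop, ‖a ^ n‖ ≤ ε ^ n := by
  have hr : spectralRadius ℂ a = 0 := by
    refine le_antisymm (iSup₂_le fun z hz => ?_) bot_le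
    suffices z = 0 by simp [this]
    by_contra hz0
    refine hz ?_
    have h := ha (algebraMap ℂ A z⁻¹) (Algebra.commutes _ _)
    have : algebraMap ℂ A z - a = algebraMap ℂ A z * (1 - algebraMap ℂ A z⁻¹ * a) := by
      rw [mul_sub, mul_one, ← mul_assoc, ← map_mul, mul_inv_cancel₀ hz0, map_one, one_mul]
    rw [spectrum.mem_resolventSet_iff, this]
    exact ((isUnit_iff_ne_zero.2 hz0).map (algebraMap ℂ A)).mul h
  have h := spectrum.pow_norm_pow_one_div_tendsto_nhds_spectralRadius a
  rw [hr] at h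
  filter_upwards [h.eventually (gt_mem_nhds (ENNReal.ofReal_pos.2 hε)),
    Filter.eventually_ge_atTop 1] with n hn hn1
  rw [ENNReal.ofReal_lt_ofReal_iff hε] at hn
  have := pow_le_pow_left₀ (by positivity) hn.le n
  rwa [one_div, Real.rpow_inv_natCast_pow (norm_nonneg _) (by omega)] at this

omit [NormedAlgebra ℂ A] in
-- Some power of `x a` has norm below `1`, and `1 - x a` is a commuting factor of the unit `1 - (x
-- a) ^ n`.
theorem IsQuasinilpotent.of_eventually_norm_pow_le {a : A}
    (h : ∀ ε : ℝ, 0 < ε → ∀ᶠ n : ℕ in Filter.atTop, ‖a ^ n‖ ≤ ε ^ n) : IsQuasinilpotent a := by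
  intro x hx
  -- This `ε` makes `‖x‖ * ε` less than `1`, even for `x = 0`. The condition `n ≥ 1` is needed
  -- because `‖1‖ ≤ 1` is not assumed.
  obtain ⟨n, hn, hn1⟩ := ((h (1 / (2 * (‖x‖ + 1))) (by positivity)).and
    (Filter.eventually_ge_atTop 1)).exists
  have hlt : ‖(x * a) ^ n‖ < 1 := by
    rw [(show Commute x a from hx).mul_pow]
    calc ‖x ^ n * a ^ n‖ ≤ ‖x ^ n‖ * ‖a ^ n‖ := norm_mul_le _ _
      _ ≤ ‖x‖ ^ n * (1 / (2 * (‖x‖ + 1))) ^ n := by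
          gcongr
          exact norm_pow_le' _ hn1
      _ = (‖x‖ / (2 * (‖x‖ + 1))) ^ n := by rw [← mul_pow, mul_one_div]
      _ < 1 := by
          refine pow_lt_one₀ (by positivity) ?_ (by omega)
          rw [div_lt_one (by positivity)]
          linarith [norm_nonneg x]
  have hu := isUnit_one_sub_of_norm_lt_one hlt
  rw [← mul_neg_geom_sum] at hu
  have hcomm : Commute (1 - x * a) (∑ i ∈ Finset.range n, (x * a) ^ i) := by
    rw [commute_iff_eq, mul_neg_geom_sum, geom_sum_mul_neg]
  exact (hcomm.isUnit_mul_iff.1 hu).1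

theorem IsQuasinilpotent.mul_of_commute {a b : A} (ha : IsQuasinilpotent a)
    (hab : a * b = b * a) : IsQuasinilpotent (a * b) := by
  refine .of_eventually_norm_pow_le fun ε hε => ?_
  filter_upwards [ha.eventually_norm_pow_le (ε := ε / (‖b‖ + 1)) (by positivity),
    Filter.eventually_ge_atTop 1] with n hn hn1
  rw [(show Commute a b from hab).mul_pow]
  calc ‖a ^ n * b ^ n‖ ≤ ‖a ^ n‖ * ‖b ^ n‖ := norm_mul_le _ _
    _ ≤ (ε / (‖b‖ + 1)) ^ n * (‖b‖ + 1) ^ n := by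
        gcongr
        exact (norm_pow_le' _ hn1).trans (by gcongr; linarith)
    _ = ε ^ n := by rw [← mul_pow, div_mul_cancel₀ _ (by positivity)]

omit [NormedAlgebra ℂ A] [CompleteSpace A] in
theorem eq_zero_of_forall_norm_le {y : A} {c : ℝ}
    (h : ∀ ε : ℝ, 0 < ε → ∀ᶠ n : ℕ in Filter.atTop, ‖y‖ ≤ c ^ n * ‖y‖ * ε ^ n) (hc : 0 ≤ c) :
    y = 0 := by
  by_contra hy
  have hy : 0 < ‖y‖ := norm_pos_iff.2 hy
  obtain ⟨n, hn, hn1⟩ := ((h (1 / (2 * (c + 1))) (by positivity)).and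
    (Filter.eventually_ge_atTop 1)).exists
  have : c ^ n * ‖y‖ * (1 / (2 * (c + 1))) ^ n = (c / (2 * (c + 1))) ^ n * ‖y‖ := by
    rw [mul_right_comm, ← mul_pow, mul_one_div]
  rw [this] at hn
  have hlt : (c / (2 * (c + 1))) ^ n < 1 := by
    refine pow_lt_one₀ (by positivity) ?_ (by omega)
    rw [div_lt_one (by positivity)]
    linarith
  nlinarith

theorem eq_pow_mul_mul_pow {M : Type*} [Monoid M] {a b y : M} (h : y = b * y * a) (n : ℕ) :
    y = b ^ n * y * a ^ n := by
  induction n with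
  | zero => simp
  | succ n ih =>
    rw [pow_succ, pow_succ', mul_assoc, mul_assoc, ← mul_assoc y, ← mul_assoc b, ← mul_assoc b,
      ← h, ← mul_assoc]
    exact ih

/-- The equation `y = b y a` has only the trivial solution if `a` is quasinilpotent. -/
theorem IsQuasinilpotent.eq_zero_of_eq_mul_mul {a b y : A} (ha : IsQuasinilpotent a)
    (h : y = b * y * a) : y = 0 := by
  refine eq_zero_of_forall_norm_le (c := ‖b‖) (fun ε hε => ?_) (norm_nonneg _)
  filter_upwards [ha.eventually_norm_pow_le hε, Filter.eventually_ge_atTop 1] with n hn hn1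
  calc ‖y‖ = ‖b ^ n * y * a ^ n‖ := congrArg _ (eq_pow_mul_mul_pow h n)
    _ ≤ ‖b ^ n‖ * ‖y‖ * ‖a ^ n‖ :=
      (norm_mul_le _ _).trans (mul_le_mul_of_nonneg_right (norm_mul_le _ _) (norm_nonneg _))
    _ ≤ ‖b‖ ^ n * ‖y‖ * ε ^ n := by
      gcongr
      exact norm_pow_le' _ hn1

/-- The equation `y = a y b` has only the trivial solution if `a` is quasinilpotent. -/
theorem IsQuasinilpotent.eq_zero_of_eq_mul_mul' {a b y : A} (ha : IsQuasinilpotent a)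
    (h : y = a * y * b) : y = 0 := by
  refine eq_zero_of_forall_norm_le (c := ‖b‖) (fun ε hε => ?_) (norm_nonneg _)
  filter_upwards [ha.eventually_norm_pow_le hε, Filter.eventually_ge_atTop 1] with n hn hn1
  calc ‖y‖ = ‖a ^ n * y * b ^ n‖ := congrArg _ (eq_pow_mul_mul_pow h n)
    _ ≤ ‖a ^ n‖ * ‖y‖ * ‖b ^ n‖ :=
      (norm_mul_le _ _).trans (mul_le_mul_of_nonneg_right (norm_mul_le _ _) (norm_nonneg _))
    _ ≤ ε ^ n * ‖y‖ * ‖b‖ ^ n := by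
      gcongr
      exact norm_pow_le' _ hn1
    _ = ‖b‖ ^ n * ‖y‖ * ε ^ n := by ring

/-- With `b` the left inverse of `t + p`, the element `y = (1 - p) q` satisfies `y = b y (q t)`,
because `t + p` acts as `t` on the range of `1 - p`. Quasinilpotence of `q t` then gives `y = 0`. -/
theorem IsLeftPInvertible.mul_eq {p q t : A} (hp : p * p = p) (hq : q * q = q)
    (ht : IsLeftPInvertible p t) (hqt : q * t = t * q) (hqn : IsQuasinilpotent (q * t)) :
    p * q = q := by
  obtain ⟨htp, b, hbp, hb⟩ := ht
  have h : (1 - p) * q = b * ((1 - p) * q) * (q * t) := by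
    linear_combination (norm := noncomm_ring) -b * (1 - p) * hq * t - b * (1 - p) * hqt
      - b * htp * q - hb * (1 - p) * q - b * hp * q
  have := hqn.eq_zero_of_eq_mul_mul h
  rw [sub_mul, one_mul, sub_eq_zero] at this
  exact this.symm

theorem IsRightPInvertible.mul_eq {p q t : A} (hp : p * p = p) (hq : q * q = q)
    (ht : IsRightPInvertible p t) (hqt : q * t = t * q) (hqn : IsQuasinilpotent (q * t)) :
    q * p = q := by
  obtain ⟨htp, b, hbp, hb⟩ := ht
  have h : q * (1 - p) = (q * t) * (q * (1 - p)) * b := by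
    linear_combination (norm := noncomm_ring) q * hqt * (1 - p) * b - hq * t * (1 - p) * b
      + q * htp * b - q * (1 - p) * hb - q * hp * b
  have := hqn.eq_zero_of_eq_mul_mul' h
  rw [mul_sub, mul_one, sub_eq_zero] at this
  exact this.symm

/-- Idempotents associated to `t` are similar, by a unit which commutes with `t`. -/
theorem exists_isUnit_mul_add_eq {p q t : A} (hp : p * p = p) (hq : q * q = q)
    (hp' : IsLeftPInvertible p t ∨ IsRightPInvertible p t)
    (hq' : IsLeftPInvertible q t ∨ IsRightPInvertible q t)
    (hpn : IsQuasinilpotent (p * t)) (hqn : IsQuasinilpotent (q * t)) :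
    ∃ u : A, IsUnit u ∧ u * (t + q) = (t + p) * u := by
  have hpt : p * t = t * p := (hp'.elim And.left And.left).symm
  have hqt : q * t = t * q := (hq'.elim And.left And.left).symm
  rcases hp' with hp' | hp' <;> rcases hq' with hq' | hq'
  · have h₁ := hp'.mul_eq hp hq hqt hqn
    have h₂ := hq'.mul_eq hq hp hpt hpn
    -- Here `p q = q` and `q p = p`, so `(q - p) ^ 2 = 0`.
    refine ⟨1 + (q - p), ⟨⟨1 + (q - p), 1 - (q - p), ?_, ?_⟩, rfl⟩, ?_⟩
    · linear_combination (norm := noncomm_ring) h₁ + h₂ - hp - hq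
    · linear_combination (norm := noncomm_ring) h₁ + h₂ - hp - hq
    · linear_combination (norm := noncomm_ring) hqt - hpt + hq - h₁ - h₁ + hp
  · have h₁ := hp'.mul_eq hp hq hqt hqn
    have h₂ := hq'.mul_eq hq hp hpt hpn
    -- In the mixed case the two lemmas evaluate the same product `p q` as `q` and as `p`, so the
    -- idempotents coincide.
    rw [h₁] at h₂
    exact ⟨1, isUnit_one, by rw [h₂, one_mul, mul_one]⟩
  · have h₁ := hp'.mul_eq hp hq hqt hqn
    have h₂ := hq'.mul_eq hq hp hpt hpn
    rw [h₁] at h₂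
    exact ⟨1, isUnit_one, by rw [h₂, one_mul, mul_one]⟩
  · have h₁ := hp'.mul_eq hp hq hqt hqn
    have h₂ := hq'.mul_eq hq hp hpt hpn
    refine ⟨1 - (q - p), ⟨⟨1 - (q - p), 1 + (q - p), ?_, ?_⟩, rfl⟩, ?_⟩
    · linear_combination (norm := noncomm_ring) h₁ + h₂ - hp - hq
    · linear_combination (norm := noncomm_ring) h₁ + h₂ - hp - hq
    · linear_combination (norm := noncomm_ring) hpt - hqt - hq + h₂ + h₂ - hp

end BanachAlgebra

/-! ### Banach algebra structure of the Calkin algebra. -/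

section Calkin

variable {X : Type*} [NormedAddCommGroup X] [NormedSpace ℂ X] [CompleteSpace X]

instance isClosed_compactIdeal : IsClosed (compactIdeal X : Set (X →L[ℂ] X)) :=
  isClosed_setOfPred_isCompactOperator

/-- The Calkin algebra is a Banach algebra for the quotient norm. -/
instance : NormedRing (Calkin X) where
  __ := Submodule.Quotient.normedAddCommGroup (compactIdeal X)
  __ := (inferInstance : Ring (Calkin X))
  norm_mul_le x y := by
    refine le_of_forall_pos_le_add fun ε hε => ?_
    have hcont : Filter.Tendsto (fun δ : ℝ => (‖x‖ + δ) * (‖y‖ + δ)) (nhds 0)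
        (nhds (‖x‖ * ‖y‖)) := by
      have : Continuous fun δ : ℝ => (‖x‖ + δ) * (‖y‖ + δ) := by fun_prop
      simpa using this.tendsto 0
    obtain ⟨δ, hδ, hδ₀⟩ := (((hcont.mono_left nhdsWithin_le_nhds).eventually
      (gt_mem_nhds (lt_add_of_pos_right (‖x‖ * ‖y‖) hε))).and
      (self_mem_nhdsWithin (s := Set.Ioi (0 : ℝ)))).exists
    obtain ⟨a, rfl, ha⟩ := Submodule.Quotient.norm_mk_lt x hδ₀
    obtain ⟨b, rfl, hb⟩ := Submodule.Quotient.norm_mk_lt y hδ₀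
    calc _ ≤ ‖a * b‖ := Submodule.Quotient.norm_mk_le (S := compactIdeal X) (a * b)
      _ ≤ ‖a‖ * ‖b‖ := norm_mul_le a b
      _ ≤ _ := by gcongr
      _ ≤ _ := hδ.le

instance : NormedAlgebra ℂ (Calkin X) where
  __ := (inferInstance : Algebra ℂ (Calkin X))
  norm_smul_le := norm_smul_le

instance : CompleteSpace (Calkin X) :=
  Submodule.Quotient.completeSpace (compactIdeal X)

end Calkin

/-! ### Associated idempotents, well-definedness of the index and the logarithmic law. -/

section Associated

variable {X : Type*} [NormedAddCommGroup X] [NormedSpace ℂ X]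

theorem IsPInvertible.isLeftPInvertible {A : Type*} [Ring A] {p a : A} (h : IsPInvertible p a) :
    IsLeftPInvertible p a := by
  obtain ⟨w, hw, -, hwp⟩ := exists_mul_inverse_commute (p := p) h.2 (by rw [add_mul, mul_add, h.1])
  exact ⟨h.1, w, hwp, hw⟩

theorem IsPInvertible.isRightPInvertible {A : Type*} [Ring A] {p a : A} (h : IsPInvertible p a) :
    IsRightPInvertible p a := by
  obtain ⟨w, -, hw, hwp⟩ := exists_mul_inverse_commute (p := p) h.2 (by rw [add_mul, mul_add, h.1])
  exact ⟨h.1, w, hwp, hw⟩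

theorem IsLeftPInvertible.isPInvertible {A : Type*} [Ring A] {p a : A}
    (h : IsLeftPInvertible p a) (h' : IsRightPInvertible p a) : IsPInvertible p a := by
  obtain ⟨hap, b, -, hb⟩ := h
  obtain ⟨-, c, -, hc⟩ := h'
  refine ⟨hap, ⟨⟨a + p, b, ?_, hb⟩, rfl⟩⟩
  rwa [left_inv_eq_right_inv hb hc]

theorem IsTwoSidedAssociated.isLeftAssociated {P T : X →L[ℂ] X} (h : IsTwoSidedAssociated P T) :
    IsLeftAssociated P T :=
  ⟨h.idem, h.comm, h.quasinilpotent, h.inv.isLeftPInvertible⟩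

theorem IsTwoSidedAssociated.isRightAssociated {P T : X →L[ℂ] X} (h : IsTwoSidedAssociated P T) :
    IsRightAssociated P T :=
  ⟨h.idem, h.comm, h.quasinilpotent, h.inv.isRightPInvertible⟩

theorem IsLeftAssociated.isTwoSidedAssociated {P T : X →L[ℂ] X} (h : IsLeftAssociated P T)
    (h' : IsRightAssociated P T) : IsTwoSidedAssociated P T :=
  ⟨h.idem, h.comm, h.quasinilpotent, h.leftInv.isPInvertible h'.rightInv⟩

theorem IsAssociated.exists_properties {P T : X →L[ℂ] X} (h : IsAssociated P T) :
    calkinMap P * calkinMap P = calkinMap P ∧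
      IsQuasinilpotent (calkinMap P * calkinMap T) ∧
      (IsLeftPInvertible (calkinMap P) (calkinMap T) ∨
        IsRightPInvertible (calkinMap P) (calkinMap T)) := by
  rcases h with h | h | h
  · exact ⟨by rw [← map_mul, h.idem], h.quasinilpotent, .inl h.leftInv⟩
  · exact ⟨by rw [← map_mul, h.idem], h.quasinilpotent, .inr h.rightInv⟩
  · exact ⟨by rw [← map_mul, h.idem], h.quasinilpotent, .inl h.inv.isLeftPInvertible⟩

theorem IsAssociated.isSemiInvertible {P T : X →L[ℂ] X} (h : IsAssociated P T) :
    IsSemiInvertible (T + P) := by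
  rw [IsSemiInvertible, map_add]
  exact h.exists_properties.2.2.imp (fun ⟨_, b, _, hb⟩ => ⟨b, hb⟩) (fun ⟨_, b, _, hb⟩ => ⟨b, hb⟩)

/-- Compactness of the commutator of the compressions, seen in the Calkin algebra. -/
theorem calkinMap_mul_comm_of_compression {P S T : X →L[ℂ] X} (hP : P * P = P)
    (hS : calkinMap P * calkinMap S = calkinMap S * calkinMap P)
    (hT : calkinMap P * calkinMap T = calkinMap T * calkinMap P)
    (h : IsCompactOperator (compression P S * compression P T -
      compression P T * compression P S)) :
    calkinMap P * (calkinMap S * calkinMap T) = calkinMap P * (calkinMap T * calkinMap S) := by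
  have hP' : calkinMap P * calkinMap P = calkinMap P := by rw [← map_mul, hP]
  -- Composing with `P : X → R(P)` and with the inclusion of `R(P)` carries the commutator to an
  -- operator on `X` and keeps it compact.
  have hc := (h.comp_clm (P.codRestrict (LinearMap.range (P : X →ₗ[ℂ] X))
    (fun x => ⟨x, rfl⟩))).clm_comp (LinearMap.range (P : X →ₗ[ℂ] X)).subtypeL
  have hc' : IsCompactOperator
      (P * S * P * (P * T * P) * P - P * T * P * (P * S * P) * P : X →L[ℂ] X) := hc
  rw [← calkinMap_eq_iff] at hc'
  simp only [map_mul] at hc'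
  revert hc' hS hT hP'
  generalize calkinMap P = p, calkinMap S = s, calkinMap T = t
  intro hs ht hp h
  have key : ∀ s t : Calkin X, p * s = s * p → p * t = t * p →
      p * s * p * (p * t * p) * p = p * (s * t) := fun s t hs ht => by
    have hs' : p * s * p = p * s := by rw [mul_assoc, ← hs, ← mul_assoc, hp]
    have ht' : p * t * p = p * t := by rw [mul_assoc, ← ht, ← mul_assoc, hp]
    rw [hs', ht', mul_assoc, ht', ← mul_assoc, hs', mul_assoc]
  rw [← key s t hs ht, h, key t s ht hs]

variable [CompleteSpace X]

/-- The index does not depend on the associated idempotent. -/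
theorem IsAssociated.semiFredholmIndex_eq {P Q T : X →L[ℂ] X} (hP : IsAssociated P T)
    (hQ : IsAssociated Q T) : semiFredholmIndex (T + P) = semiFredholmIndex (T + Q) := by
  obtain ⟨hp, hpn, hpi⟩ := hP.exists_properties
  obtain ⟨hq, hqn, hqi⟩ := hQ.exists_properties
  obtain ⟨u, hu, h⟩ := exists_isUnit_mul_add_eq hp hq hpi hqi hpn hqn
  obtain ⟨U, rfl⟩ := calkinMap_surjective u
  exact hP.isSemiInvertible.semiFredholmIndex_eq_of_mul_eq hQ.isSemiInvertible hu
    (by rw [map_add, map_add, h])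

theorem IsAssociated.ind_eq {P T : X →L[ℂ] X} (h : IsAssociated P T) :
    ind T = semiFredholmIndex (T + P) := by
  have hex : ∃ P : X →L[ℂ] X, IsAssociated P T := ⟨P, h⟩
  rw [ind, dif_pos hex]
  exact hex.choose_spec.semiFredholmIndex_eq h

/-- An operator which is quasinilpotent modulo the compact operators is a perturbation of index
zero of the identity. -/
theorem semiFredholmIndex_one_add_of_isQuasinilpotent {N : X →L[ℂ] X}
    (h : IsQuasinilpotent (calkinMap N)) :
    IsUnit (calkinMap (1 + N)) ∧ semiFredholmIndex (1 + N) = 0 := by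
  refine ⟨by rw [map_add, map_one]; exact h.isUnit_one_add,
    semiFredholmIndex_one_add_eq_zero fun s => ?_⟩
  -- Quasinilpotence applied to the scalar `-s` makes `1 + s N` Fredholm for every real `s`.
  have := h (calkinMap (-((s : ℂ) • 1))) (by
    rw [← map_mul, ← map_mul]
    simp)
  rw [← map_mul, ← map_one calkinMap, ← map_sub] at this
  simpa using this

/-- The class of `P S T` is the product of those of `P S` and `P T`, which commute by `hc`; a
quasinilpotent times a commuting element is quasinilpotent. -/
theorem IsQuasinilpotent.calkinMap_mul {P S T : X →L[ℂ] X} (hP : P * P = P)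
    (hS : calkinMap P * calkinMap S = calkinMap S * calkinMap P)
    (hT : calkinMap P * calkinMap T = calkinMap T * calkinMap P)
    (hq : IsQuasinilpotent (calkinMap P * calkinMap S))
    (hc : calkinMap P * (calkinMap S * calkinMap T) = calkinMap P * (calkinMap T * calkinMap S)) :
    IsQuasinilpotent (calkinMap P * (calkinMap S * calkinMap T)) := by
  have hP' : calkinMap P * calkinMap P = calkinMap P := by rw [← map_mul, hP]
  revert hS hT hq hP' hc
  generalize calkinMap P = p, calkinMap S = s, calkinMap T = t
  intro hs ht hq hc hp
  have key : ∀ s t : Calkin X, p * s = s * p → p * s * (p * t) = p * (s * t) := fun s t hs => by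
    rw [← mul_assoc, mul_assoc p s p, ← hs, ← mul_assoc, hp, mul_assoc]
  rw [← key s t hs]
  exact hq.mul_of_commute (by rw [key s t hs, key t s ht, hc])

theorem IsLeftAssociated.mul {P S T : X →L[ℂ] X} (hS : IsLeftAssociated P S)
    (hT : IsLeftAssociated P T)
    (hc : calkinMap P * (calkinMap S * calkinMap T) = calkinMap P * (calkinMap T * calkinMap S)) :
    IsLeftAssociated P (S * T) := by
  have hq := hS.quasinilpotent.calkinMap_mul hS.idem hS.comm hT.comm hc
  have h := hS.leftInv.mul (by rw [← map_mul, hS.idem]) hT.leftInv hq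
  rw [← map_mul] at hq h
  exact ⟨hS.idem, h.1.symm, hq, h⟩

theorem IsRightAssociated.mul {P S T : X →L[ℂ] X} (hS : IsRightAssociated P S)
    (hT : IsRightAssociated P T)
    (hc : calkinMap P * (calkinMap S * calkinMap T) = calkinMap P * (calkinMap T * calkinMap S)) :
    IsRightAssociated P (S * T) := by
  have hq := hS.quasinilpotent.calkinMap_mul hS.idem hS.comm hT.comm hc
  have h := hS.rightInv.mul (by rw [← map_mul, hS.idem]) hT.rightInv hq
  rw [← map_mul] at hq h
  exact ⟨hS.idem, h.1.symm, hq, h⟩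

/-- The logarithmic law, reduced to the semi-Fredholm operators `S + P` and `T + P`. -/
theorem IsAssociated.ind_mul {P S T : X →L[ℂ] X} (hP : P * P = P) (hS : IsAssociated P S)
    (hT : IsAssociated P T) (hST : IsAssociated P (S * T))
    (hc : calkinMap P * (calkinMap S * calkinMap T) = calkinMap P * (calkinMap T * calkinMap S))
    (h : semiFredholmIndex ((S + P) * (T + P)) =
      semiFredholmIndex (S + P) + semiFredholmIndex (T + P))
    (hsemi : IsSemiInvertible ((S + P) * (T + P))) :
    ind (S * T) = ind S + ind T := by
  rw [hST.ind_eq, hS.ind_eq, hT.ind_eq, ← h]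
  obtain ⟨-, hSn, hSi⟩ := hS.exists_properties
  obtain ⟨-, hTn, hTi⟩ := hT.exists_properties
  obtain ⟨-, hSTn, -⟩ := hST.exists_properties
  have hid := one_add_mul_one_add_mul_eq (by rw [← map_mul, hP]) (hSi.elim And.left And.left)
    (hTi.elim And.left And.left) hc
  simp only [← map_mul, ← map_add, ← map_one calkinMap] at hid hSn hTn hSTn
  obtain ⟨huS, hS₀⟩ := semiFredholmIndex_one_add_of_isQuasinilpotent hSn
  obtain ⟨huT, hT₀⟩ := semiFredholmIndex_one_add_of_isQuasinilpotent hTn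
  obtain ⟨huST, hST₀⟩ := semiFredholmIndex_one_add_of_isQuasinilpotent hSTn
  have hu : IsUnit (calkinMap ((1 + P * S) * (1 + P * T))) := by
    rw [map_mul]
    exact huS.mul huT
  have hu₀ : semiFredholmIndex ((1 + P * S) * (1 + P * T)) = 0 := by
    rw [(IsSemiInvertible.of_isUnit huT).semiFredholmIndex_unit_mul huS, hS₀, hT₀, add_zero]
  -- Both sides of `hid` are a unit of index zero times a semi-invertible class, so equality of
  -- their indices is the claim.
  rw [← mul_assoc] at hid
  have hl := hST.isSemiInvertible.semiFredholmIndex_unit_mul hu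
  have hr := hsemi.semiFredholmIndex_unit_mul huST
  rw [hu₀, zero_add] at hl
  rw [hST₀, zero_add] at hr
  rw [← hl, ← hr]
  exact (hsemi.unit_mul huST).semiFredholmIndex_congr hid.symm |>.symm

theorem IsLeftAssociated.ind_mul {P S T : X →L[ℂ] X} (hS : IsLeftAssociated P S)
    (hT : IsLeftAssociated P T)
    (hc : calkinMap P * (calkinMap S * calkinMap T) = calkinMap P * (calkinMap T * calkinMap S)) :
    ind (S * T) = ind S + ind T := by
  obtain ⟨-, b, -, hb⟩ := hS.leftInv
  obtain ⟨-, c, -, hc'⟩ := hT.leftInv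
  rw [← map_add] at hb hc'
  refine IsAssociated.ind_mul hS.idem (.inl hS) (.inl hT) (.inl (hS.mul hT hc)) hc
    (semiFredholmIndex_mul_of_left_inv ⟨b, hb⟩ ⟨c, hc'⟩) (.inl ⟨c * b, ?_⟩)
  rw [map_mul, mul_assoc, ← mul_assoc b, hb, one_mul, hc']

theorem IsRightAssociated.ind_mul {P S T : X →L[ℂ] X} (hS : IsRightAssociated P S)
    (hT : IsRightAssociated P T)
    (hc : calkinMap P * (calkinMap S * calkinMap T) = calkinMap P * (calkinMap T * calkinMap S)) :
    ind (S * T) = ind S + ind T := by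
  obtain ⟨-, b, -, hb⟩ := hS.rightInv
  obtain ⟨-, c, -, hc'⟩ := hT.rightInv
  rw [← map_add] at hb hc'
  refine IsAssociated.ind_mul hS.idem (.inr (.inl hS)) (.inr (.inl hT))
    (.inr (.inl (hS.mul hT hc))) hc
    (semiFredholmIndex_mul_of_right_inv ⟨b, hb⟩ ⟨c, hc'⟩) (.inr ⟨c * b, ?_⟩)
  rw [map_mul, mul_assoc, ← mul_assoc _ c, hc', one_mul, hb]

end Associated

end FredholmType

end
theorem theorem4p6 {X : Type*} [NormedAddCommGroup X] [NormedSpace ℂ X] [CompleteSpace X] :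
    -- the index is meaningful and does not depend on the associated idempotent
    (∀ T P : X →L[ℂ] X, FredholmType.IsAssociated P T →
      (FredholmType.nullity (T + P) ≠ ⊤ ∨ FredholmType.defect (T + P) ≠ ⊤) ∧
      FredholmType.ind T = FredholmType.semiFredholmIndex (T + P)) ∧
    -- the left case
    (∀ S T P : X →L[ℂ] X,
      FredholmType.IsLeftAssociated P S → FredholmType.IsLeftAssociated P T →
      IsCompactOperator
        (FredholmType.compression P S * FredholmType.compression P T -
          FredholmType.compression P T * FredholmType.compression P S) →
      FredholmType.IsLeftPseudoSemiBFredholm (S * T) ∧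
        FredholmType.ind (S * T) = FredholmType.ind S + FredholmType.ind T) ∧
    -- the right case
    (∀ S T P : X →L[ℂ] X,
      FredholmType.IsRightAssociated P S → FredholmType.IsRightAssociated P T →
      IsCompactOperator
        (FredholmType.compression P S * FredholmType.compression P T -
          FredholmType.compression P T * FredholmType.compression P S) →
      FredholmType.IsRightPseudoSemiBFredholm (S * T) ∧
        FredholmType.ind (S * T) = FredholmType.ind S + FredholmType.ind T) ∧
    -- the two-sided case
    (∀ S T P : X →L[ℂ] X,
      FredholmType.IsTwoSidedAssociated P S → FredholmType.IsTwoSidedAssociated P T →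
      IsCompactOperator
        (FredholmType.compression P S * FredholmType.compression P T -
          FredholmType.compression P T * FredholmType.compression P S) →
      FredholmType.IsPseudoBFredholm (S * T) ∧
        FredholmType.ind (S * T) = FredholmType.ind S + FredholmType.ind T) := by
  refine ⟨fun T P h => ⟨h.isSemiInvertible.nullity_ne_top_or_defect_ne_top, h.ind_eq⟩,
    fun S T P hS hT h => ?_, fun S T P hS hT h => ?_, fun S T P hS hT h => ?_⟩ <;>
  have hc := FredholmType.calkinMap_mul_comm_of_compression hS.idem hS.comm hT.comm h
  · exact ⟨⟨P, hS.mul hT hc⟩, hS.ind_mul hT hc⟩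
  · exact ⟨⟨P, hS.mul hT hc⟩, hS.ind_mul hT hc⟩
  · exact ⟨⟨P, (hS.isLeftAssociated.mul hT.isLeftAssociated hc).isTwoSidedAssociated
      (hS.isRightAssociated.mul hT.isRightAssociated hc)⟩,
      hS.isLeftAssociated.ind_mul hT.isLeftAssociated hc⟩
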